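/- Write $\hat t_k=\binom{2k}{k}^3/(-64)^k$ and $t_k=(4k+1)\hat t_k$ for integers $k\ge 0$. For a sequence $t_k$ of nonzero numbers, nonzero polynomials $(a,b,c)$ form a Gosper representation of $t_k$ if $\frac{t_{k+1}}{t_k}=\frac{a(k)}{b(k)}\cdot\frac{c(k+1)}{c(k)}$ for all $k\ge 0$ (with no vanishing denominator) and $\gcd(a(k),b(k+h))=1$ for every integer $h\ge 0$. Then the following hold. (0) Bauer's series: $\sum_{k=0}^\infty (4k+1)\frac{\binom{2k}{k}^3}{(-64)^k}=\frac2\pi$ (as the limit of its partial sums). Moreover $\left(-(2k+1)^3,\;8(k+1)^3,\;4k+1\right)$ is a Gosper representation of $t_k$. In each of (1)–(5) the displayed telescoping relation holds for all $k\ge 0$, $\lim_{k\to\infty} g_i(k)=0$, and the displayed series converges absolutely to the displayed value. (1) With $g_1(k)=-\frac{8k^3}{(2k-1)^2}\hat t_k$, so $g_1(0)=0$: $\;t_k+\frac{8k^2-2k}{(2k-1)^2}\hat t_k=g_1(k+1)-g_1(k)$, and $$\sum_{k=0}^\infty \frac{k(4k-1)}{(2k-1)^2}\frac{\binom{2k}{k}^3}{(-64)^k}=-\frac1\pi.$$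 (2) With $g_2(k)=-2k\,\hat t_k$, so $g_2(0)=0$: $\;t_k-\frac14\frac{(4k+3)(2k+1)}{(k+1)^2}\hat t_k=g_2(k+1)-g_2(k)$, and $$\sum_{k=0}^\infty \frac{(4k+3)(2k+1)}{(k+1)^2}\frac{\binom{2k}{k}^3}{(-64)^k}=\frac8\pi.$$ (3) With $g_3(k)=-\frac{4k^2}{2k-1}\hat t_k$, so $g_3(0)=0$: $\;t_k+\frac12\frac{4k+1}{(k+1)(2k-1)}\hat t_k=g_3(k+1)-g_3(k)$, and $$\sum_{k=0}^\infty \frac{4k+1}{(k+1)(2k-1)}\frac{\binom{2k}{k}^3}{(-64)^k}=-\frac4\pi.$$ (4) With $g_4(k)=-\frac{16k^3(k-1)}{(2k-1)^3}\hat t_k$, so $g_4(0)=0$: $\;t_k-\frac{4k-1}{(2k-1)^3}\hat t_k=g_4(k+1)-g_4(k)$, and $$\sum_{k=0}^\infty \frac{4k-1}{(2k-1)^3}\frac{\binom{2k}{k}^3}{(-64)^k}=\frac2\pi.$$ (5) With $g_5(k)=-(2k+1)\hat t_k$, so $g_5(0)=-1$: $\;t_k+\frac18\frac{4k+3}{(k+1)^3}\hat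 t_k=g_5(k+1)-g_5(k)$, and $$\sum_{k=0}^\infty \frac{4k+3}{(k+1)^3}\frac{\binom{2k}{k}^3}{(-64)^k}=8-\frac{16}{\pi}.$$ -/

import Mathlib

open Filter Topology Polynomial

/-- `(a, b, c)` is a Gosper representation of the (nowhere vanishing) sequence `t`:
`a`, `b`, `c` are nonzero polynomials with `t (k+1) / t k = (a k / b k) * (c (k+1) / c k)` for all
`k`, no denominator vanishing, and `gcd (a(k), b(k+h)) = 1` for every integer `h ≥ 0`. -/
def IsGosperRepresentation {K : Type*} [Field K] (t : ℕ → K) (a b c : K[X]) : Prop :=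
  a ≠ 0 ∧ b ≠ 0 ∧ c ≠ 0 ∧
  (∀ h : ℕ, IsCoprime a (b.comp (X + C (h : K)))) ∧
  (∀ k : ℕ, t k ≠ 0 ∧ b.eval (k : K) ≠ 0 ∧ c.eval (k : K) ≠ 0 ∧
    t (k + 1) / t k =
      (a.eval (k : K) / b.eval (k : K)) * (c.eval ((k : K) + 1) / c.eval (k : K)))

/-- The term `C(2k,k)^3 / (-64)^k`. -/
noncomputable def tHat (k : ℕ) : ℝ := ((2 * k).choose k : ℝ) ^ 3 / (-64 : ℝ) ^ k

/-- The term `(4k+1) C(2k,k)^3 / (-64)^k` of Bauer's series. -/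
noncomputable def bauerTerm (k : ℕ) : ℝ := (4 * (k : ℝ) + 1) * tHat k

/-- `r(k) tHat k` with `r(k) = -8k^3/(2k-1)^2`. -/
noncomputable def g₁ (k : ℕ) : ℝ := -(8 * (k : ℝ) ^ 3 / (2 * (k : ℝ) - 1) ^ 2) * tHat k

/-- `r(k) tHat k` with `r(k) = -2k`. -/
noncomputable def g₂ (k : ℕ) : ℝ := -(2 * (k : ℝ)) * tHat k

/-- `r(k) tHat k` with `r(k) = -4k^2/(2k-1)`. -/
noncomputable def g₃ (k : ℕ) : ℝ := -(4 * (k : ℝ) ^ 2 / (2 * (k : ℝ) - 1)) * tHat k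

/-- `r(k) tHat k` with `r(k) = -16k^3(k-1)/(2k-1)^3`. -/
noncomputable def g₄ (k : ℕ) : ℝ :=
  -(16 * (k : ℝ) ^ 3 * ((k : ℝ) - 1) / (2 * (k : ℝ) - 1) ^ 3) * tHat k

/-- `r(k) tHat k` with `r(k) = -(2k+1)`. -/
noncomputable def g₅ (k : ℕ) : ℝ := -(2 * (k : ℝ) + 1) * tHat k

/-!
Put `wₙ(a) = (a)ₙ (b)ₙ (c)ₙ / (n! (1 + a - b)ₙ (1 + a - c)ₙ)` and let `Sₙ(a)` be the sum of the
first `n` terms `(-1)ᵏ (a + 2k) / a wₖ(a)`; Bauer's series is the case `a = b = c = 1/2`. Shifting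
`a` by one costs only an explicit factor and a boundary term (a Wilf–Zeilberger pair):
`Sₙ(a) = (1 + a)(1 + a - b - c) / ((1 + a - b)(1 + a - c)) Sₙ(a + 1) - (-1)ⁿ n wₙ(a) / a`.
The boundary term tends to `0`. After `M` shifts the accumulated factor is a quotient of rising
factorials, which converges to a quotient of Gamma values as `M → ∞`, while by dominated convergence
only the term `1` of index `0` survives in the shifted series. Domination needs absolute
convergence, which Bauer's series lacks but a single shift provides.

The other five series are absolutely convergent, and each arises from Bauer's series by subtracting
it from a telescoping sum.
-/

open Asymptotics
open scoped Nat

theorem mul_ascPochhammer_eval_add_one {R : Type*} [CommSemiring R] (s : R) (n : ℕ) :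
    s * (ascPochhammer R n).eval (s + 1) = (ascPochhammer R n).eval s * (s + n) := by
  rw [← ascPochhammer_succ_eval, ascPochhammer_succ_left, eval_mul, eval_X, eval_comp, eval_add,
    eval_X, eval_one]

theorem ascPochhammer_eval_eq_prod {R : Type*} [CommSemiring R] (s : R) (n : ℕ) :
    (ascPochhammer R n).eval s = ∏ i ∈ Finset.range n, (s + i) := by
  induction n with
  | zero => simp
  | succ n ih => rw [ascPochhammer_succ_eval, ih, Finset.prod_range_succ]

/-- `(s)ₙ / (n! n ^ (s - 1))`, the growth rate of the rising factorial `(s)ₙ` being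
`n! n ^ (s - 1)`. -/
noncomputable def normalizedAscPochhammer (s : ℝ) (n : ℕ) : ℝ :=
  (ascPochhammer ℝ n).eval s / (n ! * (n : ℝ) ^ (s - 1))

theorem ascPochhammer_eval_eq_normalized_mul (s : ℝ) {n : ℕ} (hn : n ≠ 0) :
    (ascPochhammer ℝ n).eval s = normalizedAscPochhammer s n * (n ! * (n : ℝ) ^ (s - 1)) := by
  rw [normalizedAscPochhammer, div_mul_cancel₀]
  positivity

theorem tendsto_normalizedAscPochhammer (s : ℝ) :
    Tendsto (normalizedAscPochhammer s) atTop (𝓝 (Real.Gamma s)⁻¹) := by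
  by_cases hs : ∃ m : ℕ, s = -m
  · obtain ⟨m, rfl⟩ := hs
    rw [Real.Gamma_neg_nat_eq_zero, inv_zero]
    refine tendsto_const_nhds.congr' ?_
    filter_upwards [eventually_gt_atTop m] with n hn
    rw [normalizedAscPochhammer, ascPochhammer_eval_neg_coe_nat_of_lt hn, zero_div]
  · push Not at hs
    have hΓ := (Real.GammaSeq_tendsto_Gamma s).inv₀ (Real.Gamma_ne_zero hs)
    have hlin : Tendsto (fun n : ℕ => (n : ℝ) / (s + n)) atTop (𝓝 1) := by
      simpa using tendsto_add_mul_div_add_mul_atTop_nhds (0 : ℝ) s 1 one_ne_zero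
    refine (mul_one (Real.Gamma s)⁻¹ ▸ hΓ.mul hlin).congr' ?_
    filter_upwards [eventually_ne_atTop 0] with n hn
    have hsn : s + n ≠ 0 := fun h => hs n (eq_neg_of_add_eq_zero_left h)
    rw [normalizedAscPochhammer, Real.GammaSeq, ← ascPochhammer_eval_eq_prod,
      ascPochhammer_succ_eval, Real.rpow_sub_one (by positivity)]
    field_simp

theorem tendsto_ascPochhammer_mul_div_mul {s t u v : ℝ} (hu : 0 < u) (hv : 0 < v)
    (h : s + t = u + v) :
    Tendsto (fun n : ℕ => (ascPochhammer ℝ n).eval s * (ascPochhammer ℝ n).eval t /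
        ((ascPochhammer ℝ n).eval u * (ascPochhammer ℝ n).eval v)) atTop
      (𝓝 (Real.Gamma u * Real.Gamma v / (Real.Gamma s * Real.Gamma t))) := by
  have hΓ : (Real.Gamma u)⁻¹ * (Real.Gamma v)⁻¹ ≠ 0 := by positivity
  have hlim := ((tendsto_normalizedAscPochhammer s).mul (tendsto_normalizedAscPochhammer t)).div
    ((tendsto_normalizedAscPochhammer u).mul (tendsto_normalizedAscPochhammer v)) hΓ
  rw [← mul_inv, ← mul_inv, inv_div_inv] at hlim
  refine hlim.congr' ?_
  filter_upwards [eventually_ne_atTop 0] with n hn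
  have hn' : (0 : ℝ) < n := by positivity
  have hpow : (n : ℝ) ^ (s - 1) * (n : ℝ) ^ (t - 1) = (n : ℝ) ^ (u - 1) * (n : ℝ) ^ (v - 1) := by
    rw [← Real.rpow_add hn', ← Real.rpow_add hn']
    congr 1
    linarith
  have hgrowth : n ! * (n : ℝ) ^ (s - 1) * (n ! * (n : ℝ) ^ (t - 1)) =
      n ! * (n : ℝ) ^ (u - 1) * (n ! * (n : ℝ) ^ (v - 1)) := by
    linear_combination (n ! : ℝ) ^ 2 * hpow
  simp only [Pi.div_apply, ascPochhammer_eval_eq_normalized_mul _ hn]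
  rw [mul_mul_mul_comm, mul_mul_mul_comm (normalizedAscPochhammer u n), hgrowth,
    mul_div_mul_right _ _ (by positivity)]

/-! ### Very-well-poised series -/

/-- The well-poised hypergeometric term `(a)ₙ (b)ₙ (c)ₙ / (n! (1 + a - b)ₙ (1 + a - c)ₙ)`: each
numerator parameter is paired with a denominator parameter so that the two add up to `1 + a`. -/
noncomputable def wellPoised (a b c : ℝ) (n : ℕ) : ℝ :=
  (ascPochhammer ℝ n).eval a * (ascPochhammer ℝ n).eval b * (ascPochhammer ℝ n).eval c /
    (n ! * (ascPochhammer ℝ n).eval (1 + a - b) * (ascPochhammer ℝ n).eval (1 + a - c))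

/-- The very-well-poised term: the well-poised one times the factor `(a + 2n) / a`, which is
`(1 + a / 2)ₙ / (a / 2)ₙ`. -/
noncomputable def veryWellPoised (a b c : ℝ) (n : ℕ) : ℝ :=
  (a + 2 * n) / a * wellPoised a b c n

section

variable {a b c : ℝ}

theorem wellPoised_zero (a b c : ℝ) : wellPoised a b c 0 = 1 := by simp [wellPoised]

theorem veryWellPoised_zero (ha : a ≠ 0) (b c : ℝ) : veryWellPoised a b c 0 = 1 := by
  simp [veryWellPoised, wellPoised_zero, ha]

theorem wellPoised_succ (a b c : ℝ) (n : ℕ) :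
    wellPoised a b c (n + 1) = wellPoised a b c n *
      ((a + n) * (b + n) * (c + n) / ((n + 1) * (1 + a - b + n) * (1 + a - c + n))) := by
  simp only [wellPoised, ascPochhammer_succ_eval, Nat.factorial_succ]
  push_cast
  rw [div_mul_div_comm]
  congr 1 <;> ring

theorem wellPoised_pos (ha : 0 < a) (hb : 0 < b) (hc : 0 < c) (hab : 0 < 1 + a - b)
    (hac : 0 < 1 + a - c) (n : ℕ) : 0 < wellPoised a b c n := by
  have hpos := ascPochhammer_pos (S := ℝ) n
  have := hpos a ha
  have := hpos b hb
  have := hpos c hc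
  have := hpos _ hab
  have := hpos _ hac
  unfold wellPoised
  positivity

theorem wellPoised_add_one (ha : 0 < a) (hab : 0 < 1 + a - b) (hac : 0 < 1 + a - c) (n : ℕ) :
    wellPoised (a + 1) b c n = wellPoised a b c n *
      ((a + n) / a * ((1 + a - b) * (1 + a - c) / ((1 + a - b + n) * (1 + a - c + n)))) := by
  have shift : ∀ s : ℝ, 0 < s →
      (ascPochhammer ℝ n).eval (s + 1) = (ascPochhammer ℝ n).eval s * (s + n) / s := fun s hs => by
    rw [← mul_ascPochhammer_eval_add_one, mul_div_cancel_left₀ _ hs.ne']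
  have := (ascPochhammer_pos n _ hab).ne'
  have := (ascPochhammer_pos n _ hac).ne'
  rw [wellPoised, wellPoised, show 1 + (a + 1) - b = 1 + a - b + 1 by ring,
    show 1 + (a + 1) - c = 1 + a - c + 1 by ring, shift a ha, shift _ hab, shift _ hac]
  field_simp

theorem veryWellPoised_add_one_le (ha : 1 ≤ a) (hb : 0 < b) (hc : 0 < c)
    (habc : 2 * (b + c) < a + 2) (n : ℕ) :
    veryWellPoised (a + 1) b c n ≤ veryWellPoised a b c n := by
  have ha0 : 0 < a := by linarith
  have hab : 0 < 1 + a - b := by linarith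
  have hac : 0 < 1 + a - c := by linarith
  have hn : (0 : ℝ) ≤ n := n.cast_nonneg
  have hlin : (a + 1 + 2 * n) / (a + 1) ≤ (a + 2 * n) / a := by
    rw [div_le_div_iff₀ (by positivity) ha0]
    linarith
  have hshift : (a + n) / a * ((1 + a - b) * (1 + a - c) / ((1 + a - b + n) * (1 + a - c + n)))
      ≤ 1 := by
    -- AM-GM: `(1 - b) (1 - c) ≤ (1 - (b + c) / 2) ^ 2`
    have hbc : (1 - b) * (1 - c) ≤ a * (a + 1) := by nlinarith [sq_nonneg (b - c)]
    have hsq : (n : ℝ) ≤ n ^ 2 := by exact_mod_cast Nat.le_self_pow two_ne_zero n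
    rw [div_mul_div_comm, div_le_one (by positivity)]
    nlinarith [mul_le_mul_of_nonneg_left hbc hn, mul_le_mul_of_nonneg_left hsq ha0.le]
  have hw := wellPoised_pos ha0 hb hc hab hac n
  rw [veryWellPoised, veryWellPoised, wellPoised_add_one ha0 hab hac]
  exact mul_le_mul hlin (mul_le_of_le_one_right hw.le hshift)
    (mul_nonneg hw.le (by positivity)) (by positivity)

theorem isBigO_wellPoised (hab : 0 < 1 + a - b) (hac : 0 < 1 + a - c) :
    wellPoised a b c =O[atTop] fun n : ℕ => (n : ℝ) ^ (2 * (b + c) - a - 3) := by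
  have hΓ : (Real.Gamma (1 + a - b))⁻¹ * (Real.Gamma (1 + a - c))⁻¹ ≠ 0 := by positivity
  have hlim := (((tendsto_normalizedAscPochhammer a).mul (tendsto_normalizedAscPochhammer b)).mul
    (tendsto_normalizedAscPochhammer c)).div ((tendsto_normalizedAscPochhammer (1 + a - b)).mul
      (tendsto_normalizedAscPochhammer (1 + a - c))) hΓ
  refine isBigO_of_div_tendsto_nhds ?_ _ (hlim.congr' ?_)
  · filter_upwards [eventually_ne_atTop 0] with n hn h
    exact absurd h (by positivity)
  filter_upwards [eventually_ne_atTop 0] with n hn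
  have hn' : (0 : ℝ) < n := by positivity
  have hpow : (n : ℝ) ^ (2 * (b + c) - a - 3) = (n : ℝ) ^ (a - 1) * (n : ℝ) ^ (b - 1) *
      (n : ℝ) ^ (c - 1) / ((n : ℝ) ^ (1 + a - b - 1) * (n : ℝ) ^ (1 + a - c - 1)) := by
    rw [← Real.rpow_add hn', ← Real.rpow_add hn', ← Real.rpow_add hn', ← Real.rpow_sub hn']
    ring_nf
  simp only [wellPoised, Pi.div_apply, ascPochhammer_eval_eq_normalized_mul _ hn]
  rw [hpow]
  field_simp

theorem tendsto_mul_wellPoised (hab : 0 < 1 + a - b) (hac : 0 < 1 + a - c)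
    (habc : 2 * (b + c) < a + 2) :
    Tendsto (fun n : ℕ => n * wellPoised a b c n) atTop (𝓝 0) := by
  have hpow : Tendsto (fun n : ℕ => (n : ℝ) ^ (-(a + 2 - 2 * (b + c)))) atTop (𝓝 0) :=
    (tendsto_rpow_neg_atTop (sub_pos.2 habc)).comp tendsto_natCast_atTop_atTop
  refine ((isBigO_refl (fun n : ℕ => (n : ℝ)) atTop).mul (isBigO_wellPoised hab hac)).trans_tendsto
    (hpow.congr fun n => ?_)
  rw [← Real.rpow_one_add' n.cast_nonneg]
  · ring_nf
  · linarith

theorem summable_veryWellPoised (hab : 0 < 1 + a - b) (hac : 0 < 1 + a - c)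
    (habc : 2 * (b + c) < a + 1) : Summable (veryWellPoised a b c) := by
  have hlin : (fun n : ℕ => (a + 2 * n) / a) =O[atTop] fun n : ℕ => (n : ℝ) := by
    have hconst : (fun _ : ℕ => a) =O[atTop] fun n : ℕ => (n : ℝ) :=
      (isLittleO_const_id_atTop a).isBigO.comp_tendsto tendsto_natCast_atTop_atTop
    simpa only [div_eq_inv_mul] using
      (hconst.add ((isBigO_refl _ _).const_mul_left 2)).const_mul_left a⁻¹
  refine summable_of_isBigO_nat (g := fun n : ℕ => (n : ℝ) ^ (2 * (b + c) - a - 2))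
    (Real.summable_nat_rpow.2 (by linarith)) ?_
  refine (hlin.mul (isBigO_wellPoised hab hac)).congr_right fun n => ?_
  rw [← Real.rpow_one_add' n.cast_nonneg]
  · ring_nf
  · linarith

theorem veryWellPoised_pos (ha : 0 < a) (hb : 0 < b) (hc : 0 < c) (hab : 0 < 1 + a - b)
    (hac : 0 < 1 + a - c) (n : ℕ) : 0 < veryWellPoised a b c n :=
  mul_pos (by positivity) (wellPoised_pos ha hb hc hab hac n)

theorem sum_range_alternating_veryWellPoised (ha : 0 < a) (hab : 0 < 1 + a - b)
    (hac : 0 < 1 + a - c) (n : ℕ) :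
    ∑ k ∈ Finset.range n, (-1) ^ k * veryWellPoised a b c k =
      (1 + a) * (1 + a - b - c) / ((1 + a - b) * (1 + a - c)) *
        ∑ k ∈ Finset.range n, (-1) ^ k * veryWellPoised (a + 1) b c k -
      (-1) ^ n * (n * wellPoised a b c n) / a := by
  induction n with
  | zero => simp
  | succ n ih =>
    have : (0 : ℝ) ≤ n := n.cast_nonneg
    have : 1 + a - b + n ≠ 0 := by positivity
    have : 1 + a - c + n ≠ 0 := by positivity
    have : 1 + a ≠ 0 := by positivity
    rw [Finset.sum_range_succ, Finset.sum_range_succ, ih, veryWellPoised, veryWellPoised,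
      wellPoised_add_one ha hab hac, wellPoised_succ, add_comm a 1]
    push_cast
    field_simp
    ring

theorem summable_alternating_veryWellPoised (hab : 0 < 1 + a - b) (hac : 0 < 1 + a - c)
    (habc : 2 * (b + c) < a + 1) : Summable fun k => (-1) ^ k * veryWellPoised a b c k :=
  .of_norm (by simpa using (summable_veryWellPoised hab hac habc).norm)

theorem tendsto_sum_alternating_veryWellPoised_eq_mul_tsum (ha : 0 < a) (hab : 0 < 1 + a - b)
    (hac : 0 < 1 + a - c) (habc : 2 * (b + c) < a + 2) :
    Tendsto (fun n => ∑ k ∈ Finset.range n, (-1) ^ k * veryWellPoised a b c k) atTop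
      (𝓝 ((1 + a) * (1 + a - b - c) / ((1 + a - b) * (1 + a - c)) *
        ∑' k, (-1) ^ k * veryWellPoised (a + 1) b c k)) := by
  have hsum := (summable_alternating_veryWellPoised (a := a + 1) (b := b) (c := c)
    (by linarith) (by linarith) (by linarith)).hasSum.tendsto_sum_nat
  have hboundary : Tendsto (fun n : ℕ => (-1) ^ n * (n * wellPoised a b c n) / a) atTop (𝓝 0) := by
    have h0 := (tendsto_mul_wellPoised hab hac habc).div_const a
    rw [zero_div, tendsto_zero_iff_norm_tendsto_zero] at h0
    exact tendsto_zero_iff_norm_tendsto_zero.2 (by simpa using h0)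
  simpa only [sum_range_alternating_veryWellPoised ha hab hac, sub_zero] using
    (hsum.const_mul _).sub hboundary

theorem tsum_alternating_veryWellPoised_eq_mul_tsum (ha : 0 < a) (hab : 0 < 1 + a - b)
    (hac : 0 < 1 + a - c) (habc : 2 * (b + c) < a + 1) :
    ∑' k, (-1) ^ k * veryWellPoised a b c k =
      (1 + a) * (1 + a - b - c) / ((1 + a - b) * (1 + a - c)) *
        ∑' k, (-1) ^ k * veryWellPoised (a + 1) b c k :=
  tendsto_nhds_unique
    (summable_alternating_veryWellPoised hab hac habc).hasSum.tendsto_sum_nat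
    (tendsto_sum_alternating_veryWellPoised_eq_mul_tsum ha hab hac (by linarith))

theorem tendsto_sum_alternating_veryWellPoised_eq_ascPochhammer_mul_tsum (ha : 0 < a)
    (hab : 0 < 1 + a - b) (hac : 0 < 1 + a - c) (habc : 2 * (b + c) < a + 2) (M : ℕ) :
    Tendsto (fun n => ∑ k ∈ Finset.range n, (-1) ^ k * veryWellPoised a b c k) atTop
      (𝓝 ((ascPochhammer ℝ (M + 1)).eval (1 + a) * (ascPochhammer ℝ (M + 1)).eval (1 + a - b - c) /
          ((ascPochhammer ℝ (M + 1)).eval (1 + a - b) *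
            (ascPochhammer ℝ (M + 1)).eval (1 + a - c)) *
        ∑' k, (-1) ^ k * veryWellPoised (a + 1 + M) b c k)) := by
  induction M with
  | zero => simpa using tendsto_sum_alternating_veryWellPoised_eq_mul_tsum ha hab hac habc
  | succ M ih =>
    have : (0 : ℝ) ≤ M := M.cast_nonneg
    convert ih using 2
    rw [tsum_alternating_veryWellPoised_eq_mul_tsum (a := a + 1 + M) (by positivity) (by linarith)
      (by linarith) (by linarith), ← mul_assoc, div_mul_div_comm]
    simp only [ascPochhammer_succ_eval (M + 1)]
    push_cast
    rw [add_assoc (a + 1)]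
    congr 2 <;> ring

theorem tendsto_wellPoised_add_natCast (a b c : ℝ) (k : ℕ) :
    Tendsto (fun M : ℕ => wellPoised (a + M) b c k) atTop (𝓝 (if k = 0 then 1 else 0)) := by
  induction k with
  | zero => simp [wellPoised_zero]
  | succ k ih =>
    have hone := tendsto_add_mul_div_add_mul_atTop_nhds (a + k) (1 + a - b + k) 1 one_ne_zero
    have hzero := tendsto_add_mul_div_add_mul_atTop_nhds ((b + k) * (c + k) / (k + 1))
      (1 + a - c + k) 0 one_ne_zero
    rw [if_neg k.succ_ne_zero]
    convert ih.mul (hone.mul hzero) using 2 with M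
    · rw [wellPoised_succ, div_mul_div_comm, zero_mul, add_zero, ← mul_div_assoc (a + k + 1 * M),
        div_div]
      congr 2 <;> ring
    · simp

theorem tendsto_veryWellPoised_add_natCast (a b c : ℝ) (k : ℕ) :
    Tendsto (fun M : ℕ => veryWellPoised (a + M) b c k) atTop (𝓝 (if k = 0 then 1 else 0)) := by
  have hlin := tendsto_add_mul_div_add_mul_atTop_nhds (a + 2 * k) a 1 one_ne_zero
  convert hlin.mul (tendsto_wellPoised_add_natCast a b c k) using 2 with M
  · rw [veryWellPoised, one_mul, add_right_comm]
  · simp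

theorem tendsto_tsum_alternating_veryWellPoised (ha : 1 ≤ a) (hb : 0 < b) (hc : 0 < c)
    (habc : 2 * (b + c) < a + 1) :
    Tendsto (fun M : ℕ => ∑' k, (-1) ^ k * veryWellPoised (a + M) b c k) atTop (𝓝 1) := by
  have hab : 0 < 1 + a - b := by linarith
  have hac : 0 < 1 + a - c := by linarith
  have hdom (M k : ℕ) : ‖(-1) ^ k * veryWellPoised (a + M) b c k‖ ≤ veryWellPoised a b c k := by
    have : (0 : ℝ) ≤ M := M.cast_nonneg
    have hpos := veryWellPoised_pos (a := a + M) (by linarith) hb hc (by linarith) (by linarith) k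
    rw [norm_mul, norm_pow, norm_neg, norm_one, one_pow, one_mul, Real.norm_of_nonneg hpos.le]
    have hanti : Antitone fun M : ℕ => veryWellPoised (a + M) b c k := antitone_nat_of_succ_le
      fun M => by
        have : (0 : ℝ) ≤ M := M.cast_nonneg
        rw [Nat.cast_succ, ← add_assoc]
        exact veryWellPoised_add_one_le (by linarith) hb hc (by linarith) k
    simpa using hanti M.zero_le
  have hterm (k : ℕ) := (tendsto_veryWellPoised_add_natCast a b c k).const_mul ((-1) ^ k)
  simpa using tendsto_tsum_of_dominated_convergence (summable_veryWellPoised hab hac habc) hterm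
    (.of_forall hdom)

/-- The limit `d → ∞` of Dougall's `₅F₄` sum with numerator parameters `a, 1 + a / 2, b, c, d`. -/
theorem tendsto_sum_alternating_veryWellPoised (ha : 0 < a) (hb : 0 < b) (hc : 0 < c)
    (habc : 2 * (b + c) < a + 2) :
    Tendsto (fun n => ∑ k ∈ Finset.range n, (-1) ^ k * veryWellPoised a b c k) atTop
      (𝓝 (Real.Gamma (1 + a - b) * Real.Gamma (1 + a - c) /
        (Real.Gamma (1 + a) * Real.Gamma (1 + a - b - c)))) := by
  have hab : 0 < 1 + a - b := by linarith
  have hac : 0 < 1 + a - c := by linarith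
  have hshift := tendsto_sum_alternating_veryWellPoised_eq_ascPochhammer_mul_tsum ha hab hac habc
  have hgamma := (tendsto_add_atTop_iff_nat 1).2 (tendsto_ascPochhammer_mul_div_mul hab hac
    (show 1 + a + (1 + a - b - c) = _ by ring))
  have hlim := hgamma.mul (tendsto_tsum_alternating_veryWellPoised (a := a + 1) (by linarith) hb hc
    (by linarith))
  rw [mul_one] at hlim
  convert hshift 0 using 2
  exact tendsto_nhds_unique hlim
    (tendsto_const_nhds.congr fun M => tendsto_nhds_unique (hshift 0) (hshift M))

end

/-! ### Bauer's series -/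

theorem centralBinom_eq_ascPochhammer_div (k : ℕ) :
    (k.centralBinom : ℝ) = 4 ^ k * ((ascPochhammer ℝ k).eval (1 / 2) / k !) := by
  induction k with
  | zero => simp
  | succ k ih =>
    have hrec : ((k : ℝ) + 1) * (k + 1).centralBinom = 2 * (2 * k + 1) * k.centralBinom := by
      exact_mod_cast Nat.succ_mul_centralBinom_succ k
    refine mul_left_cancel₀ (Nat.cast_add_one_ne_zero k : (k : ℝ) + 1 ≠ 0) ?_
    rw [hrec, ih, ascPochhammer_succ_eval, Nat.factorial_succ]
    push_cast
    field_simp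
    ring

theorem tHat_eq_wellPoised (k : ℕ) :
    tHat k = (-1) ^ k * wellPoised (1 / 2) (1 / 2) (1 / 2) k := by
  have hpow : (-64 : ℝ) ^ k = (-1) ^ k * (4 ^ k) ^ 3 := by
    rw [← pow_mul, mul_comm k 3, pow_mul, ← mul_pow]
    norm_num
  have hsign : ((-1 : ℝ) ^ k) ^ 2 = 1 := by rw [← pow_mul, mul_comm, pow_mul, neg_one_sq, one_pow]
  rw [tHat, ← Nat.centralBinom_eq_two_mul_choose, centralBinom_eq_ascPochhammer_div, hpow,
    wellPoised, add_sub_cancel_right, ascPochhammer_eval_one]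
  field_simp
  rw [hsign, mul_one]

theorem tHat_succ (k : ℕ) :
    tHat (k + 1) = tHat k * (-((2 * (k : ℝ) + 1) ^ 3 / (8 * ((k : ℝ) + 1) ^ 3))) := by
  rw [tHat_eq_wellPoised, tHat_eq_wellPoised, wellPoised_succ]
  field_simp
  ring

theorem tHat_ne_zero (k : ℕ) : tHat k ≠ 0 := by
  have := Nat.choose_pos (Nat.le_mul_of_pos_left k two_pos)
  unfold tHat
  positivity

theorem isBigO_tHat : tHat =O[atTop] fun k : ℕ => (k : ℝ) ^ (-(3 / 2) : ℝ) := by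
  have hw := isBigO_wellPoised (a := 1 / 2) (b := 1 / 2) (c := 1 / 2) (by norm_num) (by norm_num)
  norm_num only at hw
  refine hw.norm_left.congr_left (fun k => ?_) |>.of_norm_left
  rw [tHat_eq_wellPoised, norm_mul, norm_pow, norm_neg, norm_one, one_pow, one_mul]

theorem tendsto_sum_bauerTerm :
    Tendsto (fun n : ℕ => ∑ k ∈ Finset.range n, bauerTerm k) atTop (𝓝 (2 / Real.pi)) := by
  have hvalue : Real.Gamma 1 * Real.Gamma 1 / (Real.Gamma (1 / 2 + 1) * Real.Gamma (1 / 2)) =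
      2 / Real.pi := by
    rw [Real.Gamma_add_one (by norm_num), Real.Gamma_one, Real.Gamma_one_half_eq, mul_assoc,
      Real.mul_self_sqrt Real.pi_nonneg]
    field_simp
  have hlim := tendsto_sum_alternating_veryWellPoised (a := 1 / 2) (b := 1 / 2) (c := 1 / 2)
    (by norm_num) (by norm_num) (by norm_num) (by norm_num)
  rw [add_sub_cancel_right, add_comm 1, show (1 : ℝ) - 1 / 2 = 1 / 2 by norm_num, hvalue] at hlim
  refine hlim.congr fun n => Finset.sum_congr rfl fun k _ => ?_
  rw [bauerTerm, tHat_eq_wellPoised, veryWellPoised]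
  ring

theorem isCoprime_two_mul_X_add_one (h : ℕ) :
    IsCoprime (2 * X + 1 : ℝ[X]) (X + C (h : ℝ) + 1) := by
  have hunit : IsUnit (2 * C (h : ℝ) + 1 : ℝ[X]) := by
    have : 2 * (h : ℝ) + 1 ≠ 0 := by positivity
    simpa only [C_add, C_mul, C_1, C_ofNat] using isUnit_C.2 this.isUnit
  obtain ⟨u, hu⟩ := hunit.exists_left_inv
  exact ⟨-u, 2 * u, by linear_combination hu⟩

theorem isGosperRepresentation_bauerTerm : IsGosperRepresentation bauerTerm
    (-(2 * X + 1) ^ 3 : ℝ[X]) (8 * (X + 1) ^ 3 : ℝ[X]) (4 * X + 1 : ℝ[X]) := by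
  have ne_zero_of_eval_zero {p : ℝ[X]} (hp : p.eval 0 ≠ 0) : p ≠ 0 := by
    rintro rfl
    exact hp eval_zero
  have hunit : IsUnit (8 : ℝ[X]) := isUnit_C.2 (by norm_num : (8 : ℝ) ≠ 0).isUnit
  refine ⟨ne_zero_of_eval_zero (by simp), ne_zero_of_eval_zero (by simp),
    ne_zero_of_eval_zero (by simp), fun h => ?_, fun k => ⟨?_, ?_, ?_, ?_⟩⟩
  · simpa using ((isCoprime_mul_unit_left_right hunit _ _).2
      (isCoprime_two_mul_X_add_one h).pow).neg_left
  · exact mul_ne_zero (by positivity) (tHat_ne_zero k)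
  · simp only [eval_mul, eval_pow, eval_add, eval_X, eval_one, eval_ofNat]
    positivity
  · simp only [eval_mul, eval_add, eval_X, eval_one, eval_ofNat]
    positivity
  · have := tHat_ne_zero k
    simp only [bauerTerm, tHat_succ, eval_neg, eval_mul, eval_pow, eval_add, eval_X, eval_one,
      eval_ofNat]
    push_cast
    field_simp

/-! ### Telescoping -/

theorem isBigO_eval_div_eval_natCast {p q : ℝ[X]} {n d : ℕ} (hp : p.degree ≤ n + d)
    (hq : q.degree = n) :
    (fun k : ℕ => p.eval (k : ℝ) / q.eval (k : ℝ)) =O[atTop] fun k => (k : ℝ) ^ d := by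
  have hO : (fun x => p.eval x) =O[atTop] fun x => (q * X ^ d).eval x :=
    isBigO_atTop_of_degree_le p (q * X ^ d) (by rwa [degree_mul, hq, degree_X_pow])
  have hcancel : (fun x => (q * X ^ d).eval x * (q.eval x)⁻¹) =O[atTop] fun x : ℝ => x ^ d := by
    refine isBigO_of_le _ fun x => ?_
    rw [eval_mul, eval_pow, eval_X, mul_right_comm, ← div_eq_mul_inv, norm_mul, norm_div]
    exact mul_le_of_le_one_left (norm_nonneg _) (div_self_le_one _)
  simp only [div_eq_mul_inv]
  exact ((hO.mul (isBigO_refl _ _)).trans hcancel).comp_tendsto tendsto_natCast_atTop_atTop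

theorem tendsto_eval_div_eval_mul_tHat {p q : ℝ[X]} {n : ℕ} (hp : p.degree ≤ n + 1)
    (hq : q.degree = n) :
    Tendsto (fun k : ℕ => p.eval (k : ℝ) / q.eval (k : ℝ) * tHat k) atTop (𝓝 0) := by
  have hpow : Tendsto (fun k : ℕ => (k : ℝ) ^ (-(1 / 2) : ℝ)) atTop (𝓝 0) :=
    (tendsto_rpow_neg_atTop (by norm_num)).comp tendsto_natCast_atTop_atTop
  refine ((isBigO_eval_div_eval_natCast (d := 1) hp hq).mul isBigO_tHat).trans_tendsto
    (hpow.congr fun k => ?_)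
  rw [pow_one, ← Real.rpow_one_add' k.cast_nonneg (by norm_num)]
  norm_num only

theorem summable_eval_div_eval_mul_tHat {p q : ℝ[X]} {n : ℕ} (hp : p.degree ≤ n)
    (hq : q.degree = n) :
    Summable fun k : ℕ => p.eval (k : ℝ) / q.eval (k : ℝ) * tHat k := by
  have hO := (isBigO_eval_div_eval_natCast (d := 0) (by simpa using hp) hq).mul isBigO_tHat
  simp only [pow_zero, one_mul] at hO
  exact summable_of_isBigO_nat (Real.summable_nat_rpow.2 (by norm_num)) hO

theorem hasSum_of_add_mul_eq_sub {K : Type*} [Field K] [TopologicalSpace K] [IsTopologicalRing K]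
    [T2Space K] {t u g : ℕ → K} {T G α s : K}
    (ht : Tendsto (fun n => ∑ k ∈ Finset.range n, t k) atTop (𝓝 T)) (hu : Summable u)
    (hg : Tendsto g atTop (𝓝 G)) (htele : ∀ k, t k + α * u k = g (k + 1) - g k) (hα : α ≠ 0)
    (hs : T + α * s = G - g 0) : HasSum u s := by
  rw [hu.hasSum_iff_tendsto_nat, ← mul_div_cancel_left₀ s hα, ← sub_eq_of_eq_add' hs.symm]
  refine (((hg.sub_const (g 0)).sub ht).div_const α).congr fun n => ?_
  rw [← Finset.sum_range_sub, ← Finset.sum_sub_distrib, Finset.sum_div]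
  refine Finset.sum_congr rfl fun k _ => ?_
  rw [← htele, add_sub_cancel_left, mul_div_cancel_left₀ _ hα]

theorem natCast_mul_two_sub_one_ne_zero (k : ℕ) : (k : ℝ) * 2 - 1 ≠ 0 := by
  rw [sub_ne_zero]
  exact_mod_cast fun h => absurd (congrArg (· % 2) h) (by simp)

theorem bauerTerm_add_eq_sub_g₁ (k : ℕ) :
    bauerTerm k + (8 * (k : ℝ) ^ 2 - 2 * (k : ℝ)) / (2 * (k : ℝ) - 1) ^ 2 * tHat k =
      g₁ (k + 1) - g₁ k := by
  have hsucc : g₁ (k + 1) = (2 * k + 1) * tHat k := by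
    rw [g₁, tHat_succ, Nat.cast_succ, show 2 * ((k : ℝ) + 1) - 1 = 2 * k + 1 by ring]
    field_simp
  have := natCast_mul_two_sub_one_ne_zero k
  rw [hsucc, bauerTerm, g₁]
  field_simp
  ring

theorem bauerTerm_sub_eq_sub_g₂ (k : ℕ) :
    bauerTerm k - 1 / 4 * ((4 * (k : ℝ) + 3) * (2 * (k : ℝ) + 1) / ((k : ℝ) + 1) ^ 2) * tHat k =
      g₂ (k + 1) - g₂ k := by
  have hsucc : g₂ (k + 1) = (2 * k + 1) ^ 3 / (4 * (k + 1) ^ 2) * tHat k := by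
    rw [g₂, tHat_succ, Nat.cast_succ]
    field_simp
    ring
  rw [hsucc, bauerTerm, g₂]
  field_simp
  ring

theorem bauerTerm_add_eq_sub_g₃ (k : ℕ) :
    bauerTerm k + 1 / 2 * ((4 * (k : ℝ) + 1) / (((k : ℝ) + 1) * (2 * (k : ℝ) - 1))) * tHat k =
      g₃ (k + 1) - g₃ k := by
  have hsucc : g₃ (k + 1) = (2 * k + 1) ^ 2 / (2 * (k + 1)) * tHat k := by
    rw [g₃, tHat_succ, Nat.cast_succ, show 2 * ((k : ℝ) + 1) - 1 = 2 * k + 1 by ring]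
    field_simp
    ring
  have := natCast_mul_two_sub_one_ne_zero k
  rw [hsucc, bauerTerm, g₃]
  field_simp
  ring

theorem bauerTerm_sub_eq_sub_g₄ (k : ℕ) :
    bauerTerm k - (4 * (k : ℝ) - 1) / (2 * (k : ℝ) - 1) ^ 3 * tHat k = g₄ (k + 1) - g₄ k := by
  have hsucc : g₄ (k + 1) = 2 * k * tHat k := by
    rw [g₄, tHat_succ, Nat.cast_succ, show 2 * ((k : ℝ) + 1) - 1 = 2 * k + 1 by ring]
    field_simp
    ring
  have := natCast_mul_two_sub_one_ne_zero k
  rw [hsucc, bauerTerm, g₄]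
  field_simp
  ring

theorem bauerTerm_add_eq_sub_g₅ (k : ℕ) :
    bauerTerm k + 1 / 8 * ((4 * (k : ℝ) + 3) / ((k : ℝ) + 1) ^ 3) * tHat k =
      g₅ (k + 1) - g₅ k := by
  have hsucc : g₅ (k + 1) = (2 * k + 3) * (2 * k + 1) ^ 3 / (8 * (k + 1) ^ 3) * tHat k := by
    rw [g₅, tHat_succ, Nat.cast_succ]
    ring
  rw [hsucc, bauerTerm, g₅]
  field_simp
  ring

theorem tendsto_g₁ : Tendsto g₁ atTop (𝓝 0) := by
  refine (tendsto_eval_div_eval_mul_tHat (p := -(8 * X ^ 3)) (q := (2 * X - 1) ^ 2)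
    (n := 2) (by compute_degree!) (by compute_degree!)).congr fun k => ?_
  simp [g₁, neg_div]

theorem tendsto_g₂ : Tendsto g₂ atTop (𝓝 0) := by
  refine (tendsto_eval_div_eval_mul_tHat (p := -(2 * X)) (q := 1)
    (n := 0) (by compute_degree!) (by compute_degree!)).congr fun k => ?_
  simp [g₂]

theorem tendsto_g₃ : Tendsto g₃ atTop (𝓝 0) := by
  refine (tendsto_eval_div_eval_mul_tHat (p := -(4 * X ^ 2)) (q := 2 * X - 1)
    (n := 1) (by compute_degree!) (by compute_degree!)).congr fun k => ?_
  simp [g₃, neg_div]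

theorem tendsto_g₄ : Tendsto g₄ atTop (𝓝 0) := by
  refine (tendsto_eval_div_eval_mul_tHat (p := -(16 * X ^ 3 * (X - 1))) (q := (2 * X - 1) ^ 3)
    (n := 3) (by compute_degree!) (by compute_degree!)).congr fun k => ?_
  simp [g₄, neg_div]

theorem tendsto_g₅ : Tendsto g₅ atTop (𝓝 0) := by
  refine (tendsto_eval_div_eval_mul_tHat (p := -(2 * X + 1)) (q := 1)
    (n := 0) (by compute_degree!) (by compute_degree!)).congr fun k => ?_
  simp [g₅]

theorem hasSum_denominator_two_mul_sub_one_sq :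
    HasSum (fun k : ℕ => (k : ℝ) * (4 * (k : ℝ) - 1) / (2 * (k : ℝ) - 1) ^ 2 * tHat k)
      (-1 / Real.pi) := by
  have hsum := summable_eval_div_eval_mul_tHat (p := X * (4 * X - 1)) (q := (2 * X - 1) ^ 2)
    (n := 2) (by compute_degree!) (by compute_degree!)
  refine hasSum_of_add_mul_eq_sub (α := 2) tendsto_sum_bauerTerm (by simpa using hsum)
    tendsto_g₁ (fun k => ?_) (by norm_num) ?_
  · rw [← bauerTerm_add_eq_sub_g₁]
    ring
  · rw [show g₁ 0 = 0 by simp [g₁]]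
    ring

theorem hasSum_denominator_add_one_sq :
    HasSum (fun k : ℕ => (4 * (k : ℝ) + 3) * (2 * (k : ℝ) + 1) / ((k : ℝ) + 1) ^ 2 * tHat k)
      (8 / Real.pi) := by
  have hsum := summable_eval_div_eval_mul_tHat (p := (4 * X + 3) * (2 * X + 1)) (q := (X + 1) ^ 2)
    (n := 2) (by compute_degree!) (by compute_degree!)
  refine hasSum_of_add_mul_eq_sub (α := -1 / 4) tendsto_sum_bauerTerm (by simpa using hsum)
    tendsto_g₂ (fun k => ?_) (by norm_num) ?_
  · rw [← bauerTerm_sub_eq_sub_g₂]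
    ring
  · rw [show g₂ 0 = 0 by simp [g₂]]
    ring

theorem hasSum_denominator_add_one_mul_two_mul_sub_one :
    HasSum (fun k : ℕ => (4 * (k : ℝ) + 1) / (((k : ℝ) + 1) * (2 * (k : ℝ) - 1)) * tHat k)
      (-4 / Real.pi) := by
  have hsum := summable_eval_div_eval_mul_tHat (p := 4 * X + 1) (q := (X + 1) * (2 * X - 1))
    (n := 2) (by compute_degree!) (by compute_degree!)
  refine hasSum_of_add_mul_eq_sub (α := 1 / 2) tendsto_sum_bauerTerm (by simpa using hsum)
    tendsto_g₃ (fun k => ?_) (by norm_num) ?_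
  · rw [← bauerTerm_add_eq_sub_g₃]
    ring
  · rw [show g₃ 0 = 0 by simp [g₃]]
    ring

theorem hasSum_denominator_two_mul_sub_one_cube :
    HasSum (fun k : ℕ => (4 * (k : ℝ) - 1) / (2 * (k : ℝ) - 1) ^ 3 * tHat k)
      (2 / Real.pi) := by
  have hsum := summable_eval_div_eval_mul_tHat (p := 4 * X - 1) (q := (2 * X - 1) ^ 3)
    (n := 3) (by compute_degree!) (by compute_degree!)
  refine hasSum_of_add_mul_eq_sub (α := -1) tendsto_sum_bauerTerm (by simpa using hsum)
    tendsto_g₄ (fun k => ?_) (by norm_num) ?_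
  · rw [← bauerTerm_sub_eq_sub_g₄]
    ring
  · rw [show g₄ 0 = 0 by simp [g₄]]
    ring

theorem hasSum_denominator_add_one_cube :
    HasSum (fun k : ℕ => (4 * (k : ℝ) + 3) / ((k : ℝ) + 1) ^ 3 * tHat k)
      (8 - 16 / Real.pi) := by
  have hsum := summable_eval_div_eval_mul_tHat (p := 4 * X + 3) (q := (X + 1) ^ 3)
    (n := 3) (by compute_degree!) (by compute_degree!)
  refine hasSum_of_add_mul_eq_sub (α := 1 / 8) tendsto_sum_bauerTerm (by simpa using hsum)
    tendsto_g₅ (fun k => ?_) (by norm_num) ?_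
  · rw [← bauerTerm_add_eq_sub_g₅]
    ring
  · rw [show g₅ 0 = -1 by simp [g₅, tHat]]
    ring

theorem mainTheorem5 :
    -- Bauer's series, which converges only conditionally
    Tendsto (fun n : ℕ => ∑ k ∈ Finset.range n,
      (4 * (k : ℝ) + 1) * ((2 * k).choose k : ℝ) ^ 3 / (-64 : ℝ) ^ k) atTop (𝓝 (2 / Real.pi)) ∧
    -- the Gosper representation of its term
    IsGosperRepresentation bauerTerm
      (-(2 * X + 1) ^ 3 : ℝ[X]) (8 * (X + 1) ^ 3 : ℝ[X]) (4 * X + 1 : ℝ[X]) ∧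
    -- denominator `(2k-1)^2`
    ((∀ k : ℕ, bauerTerm k + (8 * (k : ℝ) ^ 2 - 2 * (k : ℝ)) / (2 * (k : ℝ) - 1) ^ 2 * tHat k
        = g₁ (k + 1) - g₁ k) ∧
      Tendsto g₁ atTop (𝓝 0) ∧ g₁ 0 = 0 ∧
      HasSum (fun k : ℕ => (k : ℝ) * (4 * (k : ℝ) - 1) / (2 * (k : ℝ) - 1) ^ 2 *
        (((2 * k).choose k : ℝ) ^ 3 / (-64 : ℝ) ^ k)) (-1 / Real.pi)) ∧
    -- denominator `(k+1)^2`
    ((∀ k : ℕ, bauerTerm k -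
        1 / 4 * ((4 * (k : ℝ) + 3) * (2 * (k : ℝ) + 1) / ((k : ℝ) + 1) ^ 2) * tHat k
        = g₂ (k + 1) - g₂ k) ∧
      Tendsto g₂ atTop (𝓝 0) ∧ g₂ 0 = 0 ∧
      HasSum (fun k : ℕ => (4 * (k : ℝ) + 3) * (2 * (k : ℝ) + 1) / ((k : ℝ) + 1) ^ 2 *
        (((2 * k).choose k : ℝ) ^ 3 / (-64 : ℝ) ^ k)) (8 / Real.pi)) ∧
    -- denominator `(k+1)(2k-1)`
    ((∀ k : ℕ, bauerTerm k +
        1 / 2 * ((4 * (k : ℝ) + 1) / (((k : ℝ) + 1) * (2 * (k : ℝ) - 1))) * tHat k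
        = g₃ (k + 1) - g₃ k) ∧
      Tendsto g₃ atTop (𝓝 0) ∧ g₃ 0 = 0 ∧
      HasSum (fun k : ℕ => (4 * (k : ℝ) + 1) / (((k : ℝ) + 1) * (2 * (k : ℝ) - 1)) *
        (((2 * k).choose k : ℝ) ^ 3 / (-64 : ℝ) ^ k)) (-4 / Real.pi)) ∧
    -- denominator `(2k-1)^3`
    ((∀ k : ℕ, bauerTerm k - (4 * (k : ℝ) - 1) / (2 * (k : ℝ) - 1) ^ 3 * tHat k
        = g₄ (k + 1) - g₄ k) ∧
      Tendsto g₄ atTop (𝓝 0) ∧ g₄ 0 = 0 ∧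
      HasSum (fun k : ℕ => (4 * (k : ℝ) - 1) / (2 * (k : ℝ) - 1) ^ 3 *
        (((2 * k).choose k : ℝ) ^ 3 / (-64 : ℝ) ^ k)) (2 / Real.pi)) ∧
    -- denominator `(k+1)^3`
    ((∀ k : ℕ, bauerTerm k + 1 / 8 * ((4 * (k : ℝ) + 3) / ((k : ℝ) + 1) ^ 3) * tHat k
        = g₅ (k + 1) - g₅ k) ∧
      Tendsto g₅ atTop (𝓝 0) ∧ g₅ 0 = -1 ∧
      HasSum (fun k : ℕ => (4 * (k : ℝ) + 3) / ((k : ℝ) + 1) ^ 3 *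
        (((2 * k).choose k : ℝ) ^ 3 / (-64 : ℝ) ^ k)) (8 - 16 / Real.pi)) := by
  refine ⟨tendsto_sum_bauerTerm.congr fun n => Finset.sum_congr rfl fun k _ => ?_,
    isGosperRepresentation_bauerTerm,
    ⟨bauerTerm_add_eq_sub_g₁, tendsto_g₁, by simp [g₁], hasSum_denominator_two_mul_sub_one_sq⟩,
    ⟨bauerTerm_sub_eq_sub_g₂, tendsto_g₂, by simp [g₂], hasSum_denominator_add_one_sq⟩,
    ⟨bauerTerm_add_eq_sub_g₃, tendsto_g₃, by simp [g₃],
      hasSum_denominator_add_one_mul_two_mul_sub_one⟩,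
    ⟨bauerTerm_sub_eq_sub_g₄, tendsto_g₄, by simp [g₄], hasSum_denominator_two_mul_sub_one_cube⟩,
    ⟨bauerTerm_add_eq_sub_g₅, tendsto_g₅, by simp [g₅, tHat], hasSum_denominator_add_one_cube⟩⟩
  rw [bauerTerm, tHat, mul_div_assoc]
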